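/- Consider $m$ users, the vertices of an undirected simple graph $G=(V,E)$, who all face the same stochastic bandit problem with arms $1,\dots,K$ ($K\ge 1$). Let $P_1,\dots,P_K$ be probability distributions supported on $[0,1]$, with means $\mu_1,\dots,\mu_K$; put $\mu^*=\max_i\mu_i$ and $\Delta_i=\mu^*-\mu_i$. The rewards $X^v_i(t)$ ($v\in V$, $1\le i\le K$, $t\ge 1$) are independent random variables, and $X^v_i(t)$ has distribution $P_i$. In round $t$ each user $v$ chooses an arm $a^v(t)$ and receives $X^v_{a^v(t)}(t)$. Before choosing $a^v(t+1)$ it knows the choices and rewards, in rounds $1,\dots,t$, of all users in $\mathcal N(v)=\{v\}\cup\{u: \{u,v\}\in E\}$. Let $m^v_i(t)$ be the number of times that arm $i$ was chosen by users of $\mathcal N(v)$ in rounds $1,\dots,t$, and let $\hat\mu^v_i(t)$ be the average of the corresponding rewards. All users follow the UCB-Network policy: $a^v(t)=t$ for $1\le t\le K$, and for $t\ge K$ $$a^v(t+1)\in\operatorname*{argmax}_{j}\Big(\hat\mu^v_j(t)+\sqrt{\tfrac{2\ln t}{m^v_j(t)}}\Big),$$ where ties are broken by an arbitrary fixed measurable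 function of the information available to $v$. Let $R^G(n)=\sum_{v\in V}\sum_{t=1}^n(\mu^*-\mu_{a^v(t)})$ be the regret of the network up to the horizon $n\ge 1$. For $\beta\in(1/4,1)$ put $$b=m\left(\frac{2}{4\beta-1}+\frac{2}{(4\beta-1)^2\ln(1/\beta)}\right)\sum_{j=1}^K\Delta_j,\qquad S=\sum_{i:\mu_i<\mu^*}\left(\frac{8\ln n}{\Delta_i}+\Delta_i\right).$$ Then $R^G(n)$ is integrable and, for every $\beta\in(1/4,1)$: 1. if $G$ is fully connected (the complete graph), then $\mathbb E[R^G(n)]\le S+b$; 2. if $G$ is circular (the cycle on $m\ge 2$ vertices, a single edge when $m=2$), then $\mathbb E[R^G(n)]\le\lfloor m/2\rfloor\, S+b$; 3. if $G$ is a star on $m\ge 2$ vertices (one center adjacent to all the other vertices, and no other edges), then $\mathbb E[R^G(n)]\le(m-1)\,S+b$; 4. if $G$ is fully disconnected (no edges), then $\mathbb E[R^G(n)]\le m\,S+b$. -/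

import Mathlib

open MeasureTheory ProbabilityTheory

namespace NetworkBandit

section Information

variable {V : Type*} [Fintype V] {K : ℕ}

open Classical in
/-- The closed neighbourhood of `v`: the user `v` and its one-hop neighbours. -/
noncomputable def closedNbhd (G : SimpleGraph V) (v : V) : Finset V :=
  Finset.univ.filter fun u => u = v ∨ G.Adj v u

/-- The information available to user `v` after `t` rounds: for every user `u` in the closed
neighbourhood of `v` and every one of the `t` rounds played so far, the arm chosen by `u` in that
round and the reward that `u` received. Rounds and arms are numbered from `0`. -/
abbrev History (K : ℕ) (G : SimpleGraph V) (v : V) (t : ℕ) : Type _ :=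
  {u : V // u ∈ closedNbhd G v} → Fin t → Fin K × ℝ

/-- A (deterministic) network policy: `Φ v t h` is the arm which user `v` plays right after the
first `t` rounds, on the basis of its information `h` about these rounds. -/
abbrev Policy (K : ℕ) (G : SimpleGraph V) : Type _ :=
  (v : V) → (t : ℕ) → History K G v t → Fin K

variable {G : SimpleGraph V} {v : V} {t : ℕ}

/-- The number of times that arm `i` was chosen in the closed neighbourhood of `v`. -/
noncomputable def History.count (h : History K G v t) (i : Fin K) : ℕ :=
  ∑ u, ∑ s, if (h u s).1 = i then 1 else 0

/-- The average of the rewards of arm `i` that were collected in the closed neighbourhood of `v`. -/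
noncomputable def History.avgReward (h : History K G v t) (i : Fin K) : ℝ :=
  (∑ u, ∑ s, if (h u s).1 = i then (h u s).2 else 0) / (h.count i : ℝ)

/-- The upper confidence bound of arm `i` computed by `v` after `t` rounds. -/
noncomputable def History.ucbIndex (h : History K G v t) (i : Fin K) : ℝ :=
  h.avgReward i + √(2 * Real.log t / (h.count i : ℝ))

/-- `Φ` is a UCB-Network policy: every user plays each arm once, in order, in the first `K` rounds,
and afterwards an arm of largest upper confidence bound. Ties may be broken by any measurable
function of the information of the user. (After the first `K` rounds every arm has been sampled, so
histories in which some arm was not sampled never occur, and nothing is required on these.) -/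
structure IsUCBNetwork (Φ : Policy K G) : Prop where
  measurable : ∀ v t, Measurable (Φ v t)
  init : ∀ v t (h : History K G v t), t < K → (Φ v t h : ℕ) = t
  loop : ∀ v t (h : History K G v t), K ≤ t → (∀ j, 0 < h.count j) →
    ∀ j, h.ucbIndex j ≤ h.ucbIndex (Φ v t h)

end Information

section Dynamics

variable {V : Type*} [Fintype V] {K : ℕ} {G : SimpleGraph V}

/-- The arm chosen by user `v` in round `t` (rounds are numbered from `0`) when the network follows
`Φ` and `x u i s` is the reward which user `u` gets in round `s` if it plays arm `i` then. -/
noncomputable def action (Φ : Policy K G) (x : V → Fin K → ℕ → ℝ) (t : ℕ) (v : V) : Fin K :=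
  Φ v t fun u s => (action Φ x s u, x u (action Φ x s u) s)
termination_by t
decreasing_by all_goals exact s.isLt

/-- The mean reward `μ_i` of arm `i`, whose reward distribution is `P i`. -/
noncomputable def armMean (P : Fin K → Measure ℝ) (i : Fin K) : ℝ := ∫ y, y ∂(P i)

/-- The largest mean reward `μ^*`. -/
noncomputable def bestMean (P : Fin K → Measure ℝ) : ℝ := ⨆ i, armMean P i

/-- The gap `Δ_i = μ^* - μ_i`. -/
noncomputable def gap (P : Fin K → Measure ℝ) (i : Fin K) : ℝ := bestMean P - armMean P i

/-- The regret of the whole network in the first `n` rounds, `∑_v ∑_t (μ^* - μ_{a^v(t)})`. -/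
noncomputable def networkRegret (P : Fin K → Measure ℝ) (Φ : Policy K G)
    (x : V → Fin K → ℕ → ℝ) (n : ℕ) : ℝ :=
  ∑ v, ∑ t ∈ Finset.range n, (bestMean P - armMean P (action Φ x t v))

open Classical in
/-- `∑_{i : μ_i < μ^*} (8 ln n / Δ_i + Δ_i)`. -/
noncomputable def mainTerm (P : Fin K → Measure ℝ) (n : ℕ) : ℝ :=
  ∑ i ∈ Finset.univ.filter (fun i => armMean P i < bestMean P),
    (8 * Real.log n / gap P i + gap P i)

/-- The constant
`b = m (2 / (4β - 1) + 2 / ((4β - 1)^2 ln (1/β))) ∑_j Δ_j`. -/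
noncomputable def addTerm (P : Fin K → Measure ℝ) (m : ℕ) (β : ℝ) : ℝ :=
  m * (2 / (4 * β - 1) + 2 / ((4 * β - 1) ^ 2 * Real.log (1 / β))) * ∑ j, gap P j

end Dynamics

/-- The reward model: `X v i t` is the reward which user `v` gets from arm `i` in round `t`. All
these rewards are independent, those of arm `i` have distribution `P i`, and rewards lie
in `[0, 1]`. -/
structure IsRewardModel {V Ω : Type*} {K : ℕ} [MeasurableSpace Ω] (P : Fin K → Measure ℝ)
    (X : V → Fin K → ℕ → Ω → ℝ) (Pr : Measure Ω) : Prop where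
  measurable : ∀ v i t, Measurable (X v i t)
  law : ∀ v i t, Measure.map (X v i t) Pr = P i
  indep : iIndepFun (fun p : V × Fin K × ℕ => X p.1 p.2.1 p.2.2) Pr
  bounded : ∀ i, ∀ᵐ y ∂(P i), y ∈ Set.Icc (0 : ℝ) 1

end NetworkBandit

open NetworkBandit

/-!
Fix a suboptimal arm `i` and call a play of it early if the closed neighbourhood of the user has
played `i` fewer than `l ≈ 8 ln n / Δ_i ^ 2` times before. Let `(v, T)` be the last early play. The
early plays of users in `N(v)` lie among the fewer than `l` plays of `N(v)` before `T`, up to one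
play per user in round `T` itself. Removing `N(v)` and repeating picks out an independent set of
users, so there are at most `α(G) * l + |V|` early plays, where `α(G)` is the independence number.

A play which is not early forces a confidence bound of the user to fail. For every `λ`, the product
of `exp (λ (x - μ) - λ ^ 2 / 8)` over the plays in `N(v)` is a supermartingale by Hoeffding's lemma.
Splitting the possible numbers of plays into slices on which they vary by a factor of at most `4`,
with one `λ` for each slice, bounds the probability of a failure in round `t` by `t ^ (-3)` for each
of the two confidence bounds. In expectation these failures add at most one play per user.
-/

namespace NetworkBandit

section IndependenceNumber

open SimpleGraph

variable {V W : Type*}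

theorem indepNum_top_le_one : (⊤ : SimpleGraph V).indepNum ≤ 1 := by
  obtain ⟨I, hI⟩ := (⊤ : SimpleGraph V).exists_isNIndepSet_indepNum
  rw [← hI.card_eq]
  exact Finset.card_le_one.2 fun a ha b hb => of_not_not fun hab => hI.isIndepSet ha hb hab hab

theorem indepNum_le_card [Fintype V] (G : SimpleGraph V) : G.indepNum ≤ Fintype.card V := by
  obtain ⟨I, hI⟩ := G.exists_isNIndepSet_indepNum
  exact hI.card_eq ▸ Finset.card_le_univ I

theorem indepNum_lt_card [Fintype V] {G : SimpleGraph V} (hG : G ≠ ⊥) :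
    G.indepNum < Fintype.card V := by
  obtain ⟨I, hI⟩ := G.exists_isNIndepSet_indepNum
  obtain ⟨u, v, huv⟩ := ne_bot_iff_exists_adj.1 hG
  rw [← hI.card_eq, Finset.card_lt_iff_ne_univ]
  rintro rfl
  exact hI.isIndepSet (by simp) (by simp) huv.ne huv

theorem starGraph_ne_bot [Nontrivial V] (c : V) : starGraph c ≠ ⊥ :=
  have ⟨_, hu⟩ := exists_ne c
  ne_bot_iff_exists_adj.2 ⟨_, _, starGraph_center_adj hu.symm⟩

theorem indepNum_le_of_iso [Finite W] {G : SimpleGraph V} {H : SimpleGraph W} (e : G ≃g H) :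
    G.indepNum ≤ H.indepNum := by
  obtain ⟨I, hI⟩ := G.exists_isNIndepSet_indepNum
  have hmap : H.IsIndepSet (I.map e.toEquiv.toEmbedding : Set W) := by
    simp only [Finset.coe_map]
    rintro _ ⟨a, ha, rfl⟩ _ ⟨b, hb, rfl⟩ hab
    exact mt e.map_adj_iff.1 (hI.isIndepSet ha hb (ne_of_apply_ne _ hab))
  simpa [hI.card_eq] using hmap.card_le_indepNum

/-- An independent set of a cycle is disjoint from its shift by one. -/
theorem indepNum_cycleGraph_le {m : ℕ} (hm : 2 ≤ m) : (cycleGraph m).indepNum ≤ m / 2 := by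
  obtain ⟨k, rfl⟩ := Nat.exists_eq_add_of_le' hm
  obtain ⟨I, hI⟩ := (cycleGraph (k + 2)).exists_isNIndepSet_indepNum
  let shift : Fin (k + 2) ↪ Fin (k + 2) := (Equiv.addRight 1).toEmbedding
  have hdisj : Disjoint I (I.map shift) := by
    simp only [Finset.disjoint_left, Finset.mem_map, not_exists, not_and]
    rintro _ ha b hb rfl
    have hadj : (cycleGraph (k + 2)).Adj (b + 1) b := by simp [cycleGraph_adj]
    exact hI.isIndepSet ha hb hadj.ne hadj
  have hcard := Finset.card_le_univ (I.disjUnion _ hdisj)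
  rw [Finset.card_disjUnion, Finset.card_map, hI.card_eq, Fintype.card_fin] at hcard
  omega

end IndependenceNumber

section EarlyPlays

open Finset

variable {V : Type*}

/-- The plays, that is the pairs of a user in `S` and a round before `t` which satisfy `A`. Here `A`
stands for "the user chooses a given arm in the round". -/
def plays (A : V × ℕ → Prop) [DecidablePred A] (S : Finset V) (t : ℕ) : Finset (V × ℕ) :=
  (S ×ˢ range t).filter A

variable {A : V × ℕ → Prop} [DecidablePred A] {S S' : Finset V} {t : ℕ}

@[simp]
theorem mem_plays {p : V × ℕ} : p ∈ plays A S t ↔ (p.1 ∈ S ∧ p.2 < t) ∧ A p := by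
  simp [plays]

theorem card_plays_le : #(plays A S t) ≤ #S * t :=
  (card_filter_le _ _).trans_eq (by simp)

@[to_additive]
theorem prod_plays {M : Type*} [CommMonoid M] (f : V × ℕ → M) :
    ∏ p ∈ plays A S t, f p = ∏ u ∈ S, ∏ s ∈ range t, if A (u, s) then f (u, s) else 1 := by
  rw [plays, prod_filter, prod_product]

theorem prod_plays_succ {M : Type*} [CommMonoid M] (f : V × ℕ → M) :
    ∏ p ∈ plays A S (t + 1), f p =
      (∏ p ∈ plays A S t, f p) * ∏ u ∈ S with A (u, t), f (u, t) := by
  simp only [prod_plays, prod_range_succ, prod_mul_distrib, prod_filter]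

variable [Fintype V] {G : SimpleGraph V} {l n : ℕ}

theorem mem_closedNbhd {u v : V} : u ∈ closedNbhd G v ↔ u = v ∨ G.Adj v u := by
  simp [closedNbhd]

theorem self_mem_closedNbhd (v : V) : v ∈ closedNbhd G v := mem_closedNbhd.2 (Or.inl rfl)

/-- The plays of users in `S` before round `n` which were preceded by fewer than `l` plays in the
closed neighbourhood of the user. -/
noncomputable def earlyPlays (G : SimpleGraph V) (A : V × ℕ → Prop) [DecidablePred A] (l n : ℕ)
    (S : Finset V) : Finset (V × ℕ) :=
  {p ∈ plays A S n | #(plays A (closedNbhd G p.1) p.2) < l}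

@[simp]
theorem mem_earlyPlays {p : V × ℕ} : p ∈ earlyPlays G A l n S ↔
    p ∈ plays A S n ∧ #(plays A (closedNbhd G p.1) p.2) < l := mem_filter

open scoped Classical in
theorem card_earlyPlays_inter_closedNbhd_le {v : V} {T : ℕ} (hv : (v, T) ∈ earlyPlays G A l n S')
    (hlast : ∀ p ∈ earlyPlays G A l n S, p.2 ≤ T) :
    #(earlyPlays G A l n (S ∩ closedNbhd G v)) ≤ l + #(S ∩ closedNbhd G v) := by
  have hsub : earlyPlays G A l n (S ∩ closedNbhd G v) ⊆
      plays A (closedNbhd G v) T ∪ (S ∩ closedNbhd G v).image (·, T) := by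
    rintro ⟨u, s⟩ hp
    simp only [mem_earlyPlays, mem_plays, mem_inter] at hp
    have hs : s ≤ T := hlast (u, s) (by simp only [mem_earlyPlays, mem_plays]; tauto)
    obtain rfl | hs := hs.eq_or_lt
    · exact mem_union_right _ (mem_image_of_mem (·, s) (mem_inter.2 hp.1.1.1))
    · exact mem_union_left _ (mem_plays.2 ⟨⟨hp.1.1.1.2, hs⟩, hp.1.2⟩)
  exact (card_le_card hsub).trans <| (card_union_le _ _).trans <|
    add_le_add (mem_earlyPlays.1 hv).2.le card_image_le

open scoped Classical in
theorem card_earlyPlays_eq_add (S : Finset V) (v : V) :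
    #(earlyPlays G A l n S) = #(earlyPlays G A l n (S ∩ closedNbhd G v)) +
      #(earlyPlays G A l n (S \ closedNbhd G v)) := by
  rw [← card_filter_add_card_filter_not (fun p : V × ℕ => p.1 ∈ closedNbhd G v)]
  congr 2 <;> ext p <;> simp only [mem_filter, mem_earlyPlays, mem_plays, mem_inter, mem_sdiff] <;>
    tauto

theorem isIndepSet_insert_of_subset_sdiff_closedNbhd [DecidableEq V] {v : V} {I : Finset V}
    (hI : G.IsIndepSet (I : Set V)) (hIv : I ⊆ S \ closedNbhd G v) :
    G.IsIndepSet (insert v I : Finset V) := by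
  rw [coe_insert, SimpleGraph.isIndepSet_iff, Set.pairwise_insert]
  refine ⟨hI, fun u hu _ => ?_⟩
  have hvu : ¬ G.Adj v u := fun h => (mem_sdiff.1 (hIv hu)).2 (mem_closedNbhd.2 (Or.inr h))
  exact ⟨hvu, mt SimpleGraph.Adj.symm hvu⟩

/-- The independent set is greedy: pick the user of the last early play, discard its closed
neighbourhood and repeat. -/
theorem exists_isIndepSet_card_earlyPlays_le (S : Finset V) :
    ∃ I ⊆ S, G.IsIndepSet (I : Set V) ∧ #(earlyPlays G A l n S) ≤ #I * l + #S := by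
  classical
  induction S using Finset.strongInduction with | H S ih => ?_
  obtain hS | hS := (earlyPlays G A l n S).eq_empty_or_nonempty
  · exact ⟨∅, empty_subset S, by simp [SimpleGraph.isIndepSet_iff], by simp [hS]⟩
  obtain ⟨⟨v, T⟩, hv, hlast⟩ := exists_max_image _ Prod.snd hS
  have hvS : v ∈ S := (mem_plays.1 (mem_earlyPlays.1 hv).1).1.1
  obtain ⟨I, hIS, hI, hcard⟩ := ih (S \ closedNbhd G v)
    ((ssubset_iff_of_subset sdiff_subset).2 ⟨v, hvS, by simp [self_mem_closedNbhd]⟩)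
  have hvI : v ∉ I := fun h => (mem_sdiff.1 (hIS h)).2 (self_mem_closedNbhd v)
  refine ⟨insert v I, insert_subset hvS (hIS.trans sdiff_subset),
    isIndepSet_insert_of_subset_sdiff_closedNbhd hI hIS, ?_⟩
  calc #(earlyPlays G A l n S)
      ≤ (l + #(S ∩ closedNbhd G v)) + (#I * l + #(S \ closedNbhd G v)) :=
        (card_earlyPlays_eq_add S v).trans_le
          (add_le_add (card_earlyPlays_inter_closedNbhd_le hv hlast) hcard)
    _ = #(insert v I) * l + #S := by
        rw [card_insert_of_notMem hvI, ← card_inter_add_card_sdiff S (closedNbhd G v)]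
        ring

theorem card_earlyPlays_univ_le :
    #(earlyPlays G A l n univ) ≤ G.indepNum * l + Fintype.card V := by
  obtain ⟨I, -, hI, hcard⟩ := exists_isIndepSet_card_earlyPlays_le (G := G) (A := A) univ
  exact hcard.trans (by gcongr; exacts [hI.card_le_indepNum, le_rfl])

end EarlyPlays

section RandomCounts

open Finset

variable {Ω ι : Type*} {_ : MeasurableSpace Ω} {μ : Measure Ω} [IsFiniteMeasure μ] (s : Finset ι)
  {p : Ω → ι → Prop} [∀ ω, DecidablePred (p ω)]

theorem natCast_card_filter_eq_sum_indicator (ω : Ω) :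
    (#{k ∈ s | p ω k} : ℝ) = ∑ k ∈ s, {ω | p ω k}.indicator (fun _ => 1) ω := by
  classical
  simp only [natCast_card_filter, Set.indicator_apply, Set.mem_ofPred_eq]

theorem integrable_card_filter (hp : ∀ k ∈ s, MeasurableSet {ω | p ω k}) :
    Integrable (fun ω => (#{k ∈ s | p ω k} : ℝ)) μ := by
  simp only [natCast_card_filter_eq_sum_indicator]
  exact integrable_finsetSum _ fun k hk => (integrable_const (1 : ℝ)).indicator (hp k hk)

theorem integral_card_filter (hp : ∀ k ∈ s, MeasurableSet {ω | p ω k}) :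
    ∫ ω, (#{k ∈ s | p ω k} : ℝ) ∂μ = ∑ k ∈ s, μ.real {ω | p ω k} := by
  simp only [natCast_card_filter_eq_sum_indicator]
  rw [integral_finsetSum _ fun k hk => (integrable_const (1 : ℝ)).indicator (hp k hk)]
  exact sum_congr rfl fun k hk => integral_indicator_one (hp k hk)

end RandomCounts

section Integration

open Finset

variable {Ω ι α : Type*}

@[to_additive]
theorem measurable_prod_filter {_ : MeasurableSpace Ω} {M : Type*} [CommMonoid M]
    [MeasurableSpace M] [MeasurableMul₂ M] (s : Finset ι) {p : Ω → ι → Prop}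
    [∀ ω, DecidablePred (p ω)] {g : ι → Ω → M} (hp : ∀ k ∈ s, MeasurableSet {ω | p ω k})
    (hg : ∀ k ∈ s, Measurable (g k)) :
    Measurable fun ω => ∏ k ∈ s with p ω k, g k ω := by
  simp only [prod_filter]
  exact Finset.measurable_fun_prod _ fun k hk => (hg k hk).ite (hp k hk) measurable_const

theorem measure_le_le_ofReal_exp_neg {_ : MeasurableSpace Ω} {μ : Measure Ω} {f : Ω → ℝ}
    (hf : AEMeasurable f μ) (hint : ∫⁻ ω, ENNReal.ofReal (Real.exp (f ω)) ∂μ ≤ 1) (a : ℝ) :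
    μ {ω | a ≤ f ω} ≤ ENNReal.ofReal (Real.exp (-a)) := by
  calc μ {ω | a ≤ f ω}
      ≤ μ {ω | ENNReal.ofReal (Real.exp a) ≤ ENNReal.ofReal (Real.exp (f ω))} :=
        measure_mono fun _ hω => ENNReal.ofReal_le_ofReal (Real.exp_le_exp.2 hω)
    _ ≤ (∫⁻ ω, ENNReal.ofReal (Real.exp (f ω)) ∂μ) / ENNReal.ofReal (Real.exp a) :=
        meas_ge_le_lintegral_div (by fun_prop) (by positivity) ENNReal.ofReal_ne_top
    _ ≤ 1 / ENNReal.ofReal (Real.exp a) := by gcongr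
    _ = ENNReal.ofReal (Real.exp (-a)) := by
        rw [Real.exp_neg, ENNReal.ofReal_inv_of_pos (Real.exp_pos a), one_div]

theorem lintegral_eq_tsum_setLIntegral_fiber {m₀ : MeasurableSpace Ω} {μ : Measure Ω}
    [MeasurableSpace α] [Countable α] [MeasurableSingletonClass α] {D : Ω → α} (hD : Measurable D)
    (f : Ω → ENNReal) : ∫⁻ ω, f ω ∂μ = ∑' a, ∫⁻ ω in D ⁻¹' {a}, f ω ∂μ := by
  rw [← lintegral_iUnion (fun a => hD (measurableSet_singleton a)) fun a b hab =>
    Disjoint.preimage D (by simpa using hab), ← Set.preimage_iUnion, Set.iUnion_of_singleton,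
    Set.preimage_univ, setLIntegral_univ]

/-- On each fibre of `D` the second factor is a fixed function that is independent of the fibre. -/
theorem lintegral_mul_comp_le {m₁ m₂ m₀ : MeasurableSpace Ω} {μ : Measure Ω} (h₁ : m₁ ≤ m₀)
    (h₂ : m₂ ≤ m₀) (hindep : Indep m₁ m₂ μ) [MeasurableSpace α] [Countable α]
    [MeasurableSingletonClass α] {D : Ω → α} {Z : Ω → ENNReal} {g : α → Ω → ENNReal}
    (hD : Measurable[m₁] D) (hZ : Measurable[m₁] Z) (hg : ∀ a, Measurable[m₂] (g a))
    (hg_le : ∀ a, ∫⁻ ω, g a ω ∂μ ≤ 1) :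
    ∫⁻ ω, Z ω * g (D ω) ω ∂μ ≤ ∫⁻ ω, Z ω ∂μ := by
  have hfib : ∀ a, MeasurableSet[m₁] (D ⁻¹' {a}) := fun a => hD (measurableSet_singleton a)
  rw [lintegral_eq_tsum_setLIntegral_fiber (hD.mono h₁ le_rfl),
    lintegral_eq_tsum_setLIntegral_fiber (hD.mono h₁ le_rfl)]
  refine ENNReal.tsum_le_tsum fun a => ?_
  calc ∫⁻ ω in D ⁻¹' {a}, Z ω * g (D ω) ω ∂μ
      = ∫⁻ ω in D ⁻¹' {a}, Z ω * g a ω ∂μ :=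
        setLIntegral_congr_fun (h₁ _ (hfib a)) fun ω (hω : D ω = a) => by simp only [hω]
    _ = ∫⁻ ω, (D ⁻¹' {a}).indicator Z ω * g a ω ∂μ := by
        rw [← lintegral_indicator (h₁ _ (hfib a))]
        simp only [Set.indicator_mul_left]
    _ = (∫⁻ ω, (D ⁻¹' {a}).indicator Z ω ∂μ) * ∫⁻ ω, g a ω ∂μ :=
        lintegral_mul_eq_lintegral_mul_lintegral_of_independent_measurableSpace h₁ h₂ hindep
          (hZ.indicator (hfib a)) (hg a)
    _ ≤ ∫⁻ ω in D ⁻¹' {a}, Z ω ∂μ := by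
        rw [lintegral_indicator (h₁ _ (hfib a))]
        exact mul_le_of_le_one_right' (hg_le a)

/-- Hoeffding's lemma. -/
theorem lintegral_exp_mul_sub_mean_le_one {Q : Measure ℝ} [IsProbabilityMeasure Q]
    (hQ : ∀ᵐ y ∂Q, y ∈ Set.Icc (0 : ℝ) 1) (lam : ℝ) :
    ∫⁻ y, ENNReal.ofReal (Real.exp (lam * (y - ∫ z, z ∂Q) - lam ^ 2 / 8)) ∂Q ≤ 1 := by
  have hsub := hasSubgaussianMGF_of_mem_Icc (X := fun y : ℝ => y) aemeasurable_id hQ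
  simp only [Real.exp_sub _ (lam ^ 2 / 8)]
  rw [← ofReal_integral_eq_lintegral_ofReal ((hsub.integrable_exp_mul lam).div_const _)
    (.of_forall fun y => by positivity), integral_div, ENNReal.ofReal_le_one,
    div_le_one (Real.exp_pos _)]
  refine (hsub.mgf_le lam).trans_eq ?_
  simp only [sub_zero, nnnorm_one, NNReal.coe_pow, NNReal.coe_div, NNReal.coe_one, NNReal.coe_ofNat]
  ring_nf

end Integration

section Peeling

variable {Ω : Type*} {_ : MeasurableSpace Ω} {μ : Measure Ω} {Y N : Ω → ℝ} {L q : ℝ} {t : ℕ}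

/-- The exponential rate at which the deviation is tested on the slice `A / 4 ≤ N ≤ A`, for a
deviation of size `√(2 * L * N)`. With `x = √(N / A)` the resulting exponent is
`L * (32 / 3 * x - 64 / 9 * x ^ 2)`; the factor `16 / 3` makes it equal at both ends of the slice,
which is the best choice. -/
noncomputable def peelingRate (L A : ℝ) : ℝ := 16 / 3 * √(2 * L / A)

theorem le_peelingRate_mul_sub {A N : ℝ} (hL : 0 ≤ L) (hA : 0 < A) (hAN : A / 4 ≤ N) (hNA : N ≤ A)
    {y : ℝ} (hy : √(2 * L * N) ≤ y) :
    7 / 2 * L ≤ peelingRate L A * y - peelingRate L A ^ 2 / 8 * N := by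
  have hx1 : 1 / 2 ≤ √(N / A) :=
    Real.le_sqrt_of_sq_le (by rw [le_div_iff₀ hA]; linarith)
  have hx2 : √(N / A) ≤ 1 := Real.sqrt_le_one.2 ((div_le_one hA).2 hNA)
  have hxx : √(N / A) ^ 2 = N / A := Real.sq_sqrt (div_nonneg (by linarith) hA.le)
  have hlin : peelingRate L A * √(2 * L * N) = 16 / 3 * (2 * L * √(N / A)) := by
    rw [peelingRate, mul_assoc, ← Real.sqrt_mul (by positivity),
      show 2 * L / A * (2 * L * N) = (2 * L) ^ 2 * (N / A) by ring,
      Real.sqrt_mul (by positivity), Real.sqrt_sq (by positivity)]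
  have hquad : peelingRate L A ^ 2 / 8 * N = 64 / 9 * L * √(N / A) ^ 2 := by
    rw [peelingRate, mul_pow, hxx, Real.sq_sqrt (by positivity)]
    ring
  have hexp : 7 / 2 ≤ 32 / 3 * √(N / A) - 64 / 9 * √(N / A) ^ 2 := by
    nlinarith [mul_nonneg (sub_nonneg.2 hx1) (sub_nonneg.2 hx2)]
  calc 7 / 2 * L ≤ (32 / 3 * √(N / A) - 64 / 9 * √(N / A) ^ 2) * L := by gcongr
    _ = peelingRate L A * √(2 * L * N) - peelingRate L A ^ 2 / 8 * N := by
        rw [hlin, hquad]; ring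
    _ ≤ peelingRate L A * y - peelingRate L A ^ 2 / 8 * N := by
        have : 0 ≤ peelingRate L A := by unfold peelingRate; positivity
        gcongr

theorem exists_le_log_four_mem_slice {x : ℝ} (hq : 0 < q) (hqx : q ≤ x) (hxt : x ≤ q * t) :
    ∃ j ≤ Nat.log 4 t, q * 4 ^ (j + 1) / 4 ≤ x ∧ x ≤ q * 4 ^ (j + 1) := by
  obtain ⟨j, hj1, hj2⟩ := exists_nat_pow_near ((one_le_div hq).2 hqx) (by norm_num : (1 : ℝ) < 4)
  rw [le_div_iff₀ hq] at hj1
  rw [div_lt_iff₀ hq] at hj2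
  have hjt : 4 ^ j ≤ t := by
    have h : (4 : ℝ) ^ j ≤ t := le_of_mul_le_mul_left ((mul_comm q _).trans_le (hj1.trans hxt)) hq
    exact_mod_cast h
  refine ⟨j, Nat.le_log_of_pow_le (by norm_num) hjt, ?_, ?_⟩ <;> rw [pow_succ] at * <;> linarith

theorem measure_sqrt_le_le_log_mul_exp (hY : AEMeasurable Y μ) (hN : AEMeasurable N μ)
    (hYN : ∀ lam : ℝ, ∫⁻ ω, ENNReal.ofReal (Real.exp (lam * Y ω - lam ^ 2 / 8 * N ω)) ∂μ ≤ 1)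
    (hq : 0 < q) (hqN : ∀ ω, q ≤ N ω) (hNt : ∀ ω, N ω ≤ q * t) (hL : 0 ≤ L) :
    μ {ω | √(2 * L * N ω) ≤ Y ω} ≤
      ENNReal.ofReal ((Nat.log 4 t + 1) * Real.exp (-(7 / 2 * L))) := by
  let lam : ℕ → ℝ := fun j => peelingRate L (q * 4 ^ (j + 1))
  have hsub : {ω | √(2 * L * N ω) ≤ Y ω} ⊆ ⋃ j ∈ Finset.range (Nat.log 4 t + 1),
      {ω | 7 / 2 * L ≤ lam j * Y ω - lam j ^ 2 / 8 * N ω} := by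
    intro ω hω
    obtain ⟨j, hj, hj1, hj2⟩ := exists_le_log_four_mem_slice hq (hqN ω) (hNt ω)
    exact Set.mem_biUnion (Finset.mem_coe.2 (Finset.mem_range.2 (Nat.lt_succ_of_le hj)))
      (le_peelingRate_mul_sub hL (by positivity) hj1 hj2 hω)
  calc μ {ω | √(2 * L * N ω) ≤ Y ω}
      ≤ ∑ j ∈ Finset.range (Nat.log 4 t + 1),
          μ {ω | 7 / 2 * L ≤ lam j * Y ω - lam j ^ 2 / 8 * N ω} :=
        (measure_mono hsub).trans (measure_biUnion_finset_le _ _)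
    _ ≤ ∑ _j ∈ Finset.range (Nat.log 4 t + 1), ENNReal.ofReal (Real.exp (-(7 / 2 * L))) :=
        Finset.sum_le_sum fun j _ => measure_le_le_ofReal_exp_neg (by fun_prop) (hYN (lam j)) _
    _ = ENNReal.ofReal ((Nat.log 4 t + 1) * Real.exp (-(7 / 2 * L))) := by
        rw [Finset.sum_const, Finset.card_range, nsmul_eq_mul, ENNReal.ofReal_mul (by positivity),
          ← Nat.cast_add_one, ENNReal.ofReal_natCast]

theorem natLog_four_add_one_le_sqrt (ht : t ≠ 0) : (Nat.log 4 t + 1 : ℝ) ≤ √t := by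
  refine Real.le_sqrt_of_sq_le ?_
  have h : (Nat.log 4 t + 1) ^ 2 ≤ t :=
    calc (Nat.log 4 t + 1) ^ 2 ≤ (2 ^ Nat.log 4 t) ^ 2 :=
          Nat.pow_le_pow_left Nat.lt_two_pow_self 2
      _ = 4 ^ Nat.log 4 t := by rw [← pow_mul, mul_comm, pow_mul]; norm_num
      _ ≤ t := Nat.pow_log_le_self 4 ht
  exact_mod_cast h

theorem measure_sqrt_log_le_le_inv_pow_three (hY : AEMeasurable Y μ) (hN : AEMeasurable N μ)
    (hYN : ∀ lam : ℝ, ∫⁻ ω, ENNReal.ofReal (Real.exp (lam * Y ω - lam ^ 2 / 8 * N ω)) ∂μ ≤ 1)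
    (hq : 0 < q) (hqN : ∀ ω, q ≤ N ω) (hNt : ∀ ω, N ω ≤ q * t) (ht : t ≠ 0) :
    μ {ω | √(2 * Real.log t * N ω) ≤ Y ω} ≤ ENNReal.ofReal ((t : ℝ) ^ 3)⁻¹ := by
  have ht0 : (0 : ℝ) < t := by positivity
  have hexp : Real.exp (-(7 / 2 * Real.log t)) = (√t)⁻¹ * ((t : ℝ) ^ 3)⁻¹ := by
    rw [← mul_inv, Real.exp_neg, show 7 / 2 * Real.log t = Real.log t / 2 + (3 : ℕ) * Real.log t by
      push_cast; ring, Real.exp_add, Real.exp_half, Real.exp_nat_mul, Real.exp_log ht0]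
  refine (measure_sqrt_le_le_log_mul_exp hY hN hYN hq hqN hNt
    (Real.log_natCast_nonneg t)).trans (ENNReal.ofReal_le_ofReal ?_)
  rw [hexp, ← mul_assoc, ← div_eq_mul_inv]
  exact mul_le_of_le_one_left (by positivity)
    (div_le_one_of_le₀ (natLog_four_add_one_le_sqrt ht) (Real.sqrt_nonneg _))

theorem sum_Ico_two_mul_inv_pow_three_le_one {K : ℕ} (hK : 2 ≤ K) (n : ℕ) :
    ∑ t ∈ Finset.Ico K n, 2 * ((t : ℝ) ^ 3)⁻¹ ≤ 1 :=
  calc ∑ t ∈ Finset.Ico K n, 2 * ((t : ℝ) ^ 3)⁻¹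
      ≤ ∑ t ∈ Finset.Ico K n, ((t : ℝ) ^ 2)⁻¹ := by
        refine Finset.sum_le_sum fun t ht => ?_
        have h2t : (2 : ℝ) ≤ t := by exact_mod_cast hK.trans (Finset.mem_Ico.1 ht).1
        rw [pow_succ, mul_inv, mul_comm, mul_assoc]
        exact mul_le_of_le_one_right (by positivity) (by rwa [inv_mul_le_one₀ (by positivity)])
    _ ≤ ∑ t ∈ Finset.Ioo 1 n, ((t : ℝ) ^ 2)⁻¹ :=
        Finset.sum_le_sum_of_subset_of_nonneg (fun t => by simp; omega) fun _ _ _ => by positivity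
    _ ≤ 1 := (sum_Ioo_inv_sq_le 1 n).trans (by norm_num)

end Peeling

section Gaps

variable {K : ℕ} {P : Fin K → Measure ℝ} {i : Fin K}

theorem armMean_le_bestMean (i : Fin K) : armMean P i ≤ bestMean P :=
  le_ciSup (Set.finite_range (armMean P)).bddAbove i

theorem gap_nonneg (i : Fin K) : 0 ≤ gap P i := sub_nonneg.2 (armMean_le_bestMean i)

theorem gap_pos_iff : 0 < gap P i ↔ armMean P i < bestMean P := sub_pos

theorem gap_eq_zero_of_not_lt (h : ¬ armMean P i < bestMean P) : gap P i = 0 :=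
  le_antisymm (not_lt.1 (gap_pos_iff.not.2 h)) (gap_nonneg i)

theorem exists_armMean_eq_bestMean (P : Fin K → Measure ℝ) [Nonempty (Fin K)] :
    ∃ j, armMean P j = bestMean P :=
  exists_eq_ciSup_of_finite

theorem mainTerm_nonneg {n : ℕ} : 0 ≤ mainTerm P n :=
  Finset.sum_nonneg fun i _ => add_nonneg (div_nonneg
    (mul_nonneg (by norm_num) (Real.log_natCast_nonneg n)) (gap_nonneg i)) (gap_nonneg i)

end Gaps

section Trajectory

open Finset

variable {V : Type*} [Fintype V] {K : ℕ} {G : SimpleGraph V} {Φ : Policy K G}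
  {x : V → Fin K → ℕ → ℝ} {v : V} {i : Fin K} {t : ℕ}

/-- The information of user `v` after `t` rounds in which the network followed `Φ`. -/
noncomputable def playHistory (Φ : Policy K G) (x : V → Fin K → ℕ → ℝ) (v : V) (t : ℕ) :
    History K G v t :=
  fun u s => (action Φ x s u, x u (action Φ x s u) s)

/-- The plays of arm `i` in the closed neighbourhood of `v` in the first `t` rounds; there are
`m^v_i(t)` of them. -/
noncomputable def pulls (Φ : Policy K G) (x : V → Fin K → ℕ → ℝ) (v : V) (i : Fin K) (t : ℕ) :
    Finset (V × ℕ) :=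
  plays (fun p => action Φ x p.2 p.1 = i) (closedNbhd G v) t

/-- The sum of the rewards, each reduced by `c`, of the plays of arm `i` in the closed neighbourhood
of `v` in the first `t` rounds. -/
noncomputable def deviation (Φ : Policy K G) (x : V → Fin K → ℕ → ℝ) (c : ℝ) (v : V) (i : Fin K)
    (t : ℕ) : ℝ :=
  ∑ p ∈ pulls Φ x v i t, (x p.1 i p.2 - c)

theorem action_eq_policy_playHistory (Φ : Policy K G) (x : V → Fin K → ℕ → ℝ) (t : ℕ) (v : V) :
    action Φ x t v = Φ v t (playHistory Φ x v t) := by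
  rw [action]; rfl

theorem sum_playHistory_eq_sum_pulls {M : Type*} [AddCommMonoid M] (f : Fin K → ℝ → M) :
    (∑ u, ∑ s, if (playHistory Φ x v t u s).1 = i then
        f (playHistory Φ x v t u s).1 (playHistory Φ x v t u s).2 else 0) =
      ∑ p ∈ pulls Φ x v i t, f i (x p.1 i p.2) := by
  rw [pulls, sum_plays, ← sum_coe_sort (closedNbhd G v)]
  refine Fintype.sum_congr _ _ fun u => ?_
  rw [← Fin.sum_univ_eq_sum_range fun s => if action Φ x s u = i then f i (x u i s) else 0]
  refine Fintype.sum_congr _ _ fun s => ite_congr rfl (fun hs => ?_) fun _ => rfl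
  rw [show playHistory Φ x v t u s = (i, x u i s) by simp_all [playHistory]]

theorem count_playHistory : (playHistory Φ x v t).count i = #(pulls Φ x v i t) := by
  rw [card_eq_sum_ones]
  exact sum_playHistory_eq_sum_pulls (M := ℕ) fun _ _ => 1

theorem avgReward_playHistory_sub_mul_card (c : ℝ) (h : (pulls Φ x v i t).Nonempty) :
    ((playHistory Φ x v t).avgReward i - c) * #(pulls Φ x v i t) = deviation Φ x c v i t := by
  have hcard : (#(pulls Φ x v i t) : ℝ) ≠ 0 := by exact_mod_cast h.card_ne_zero
  rw [History.avgReward, count_playHistory, sum_playHistory_eq_sum_pulls fun _ y => y, sub_mul,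
    div_mul_cancel₀ _ hcard, deviation, sum_sub_distrib, sum_const, nsmul_eq_mul, mul_comm c]

theorem IsUCBNetwork.action_of_lt (hΦ : IsUCBNetwork Φ) (ht : t < K) :
    (action Φ x t v : ℕ) = t := by
  rw [action_eq_policy_playHistory]; exact hΦ.init v t _ ht

theorem IsUCBNetwork.card_closedNbhd_le_card_pulls (hΦ : IsUCBNetwork Φ) (ht : K ≤ t) :
    #(closedNbhd G v) ≤ #(pulls Φ x v i t) := by
  refine card_le_card_of_injOn (·, (i : ℕ)) (fun u hu => mem_coe.2 (mem_plays.2 ?_))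
    fun _ _ _ _ h => congrArg Prod.fst h
  exact ⟨⟨hu, i.2.trans_le ht⟩, Fin.ext (hΦ.action_of_lt i.2)⟩

theorem IsUCBNetwork.pulls_nonempty (hΦ : IsUCBNetwork Φ) (ht : K ≤ t) :
    (pulls Φ x v i t).Nonempty :=
  card_pos.1 ((card_pos.2 ⟨v, self_mem_closedNbhd v⟩).trans_le
    (hΦ.card_closedNbhd_le_card_pulls ht))

theorem IsUCBNetwork.pulls_action_eq_empty (hΦ : IsUCBNetwork Φ) (ht : t < K) :
    pulls Φ x v (action Φ x t v) t = ∅ := by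
  refine eq_empty_of_forall_notMem fun ⟨u, s⟩ hp => ?_
  obtain ⟨⟨-, hs⟩, hact⟩ := mem_plays.1 hp
  have hval := congrArg Fin.val hact
  simp only [hΦ.action_of_lt ht, hΦ.action_of_lt (hs.trans ht)] at hval
  exact hs.ne hval

end Trajectory

section ConfidenceBounds

open Finset

variable {V : Type*} [Fintype V] {K : ℕ} {G : SimpleGraph V} {Φ : Policy K G}
  {P : Fin K → Measure ℝ} {x : V → Fin K → ℕ → ℝ} {i j : Fin K}

/-- In round `p.2`, the average reward that user `p.1` has computed for arm `i` exceeds `μ_i` by at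
least the confidence width, or the one of arm `j` falls below `μ_j` by at least its width. Both
inequalities are multiplied by the number of plays, so that they bound sums of rewards. -/
def ConfidenceFails (P : Fin K → Measure ℝ) (Φ : Policy K G) (x : V → Fin K → ℕ → ℝ) (i j : Fin K)
    (p : V × ℕ) : Prop :=
  √(2 * Real.log p.2 * #(pulls Φ x p.1 i p.2)) ≤ deviation Φ x (armMean P i) p.1 i p.2 ∨
    √(2 * Real.log p.2 * #(pulls Φ x p.1 j p.2)) ≤ -deviation Φ x (armMean P j) p.1 j p.2

open scoped Classical in
/-- The pairs of a user and a round in `[K, n)` in which one of the two confidence bounds that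
decide between the arms `i` and `j` fails. -/
noncomputable def confidenceFailures (P : Fin K → Measure ℝ) (Φ : Policy K G)
    (x : V → Fin K → ℕ → ℝ) (i j : Fin K) (n : ℕ) : Finset (V × ℕ) :=
  {p ∈ univ ×ˢ Ico K n | ConfidenceFails P Φ x i j p}

theorem mem_confidenceFailures {p : V × ℕ} {n : ℕ} : p ∈ confidenceFailures P Φ x i j n ↔
    p.2 ∈ Ico K n ∧ ConfidenceFails P Φ x i j p := by
  simp only [confidenceFailures, mem_filter, mem_product, mem_univ, true_and]

theorem sqrt_mul_le_mul_iff {a b z : ℝ} (hb : 0 < b) : √(a * b) ≤ z * b ↔ √(a / b) ≤ z := by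
  rw [show a * b = a / b * b ^ 2 by field_simp, Real.sqrt_mul' _ (sq_nonneg b), Real.sqrt_sq hb.le,
    mul_le_mul_iff_left₀ hb]

theorem sqrt_div_le_half {a b d : ℝ} (hb : 0 < b) (hd : 0 < d) (h : 4 * a / d ^ 2 ≤ b) :
    √(a / b) ≤ d / 2 := by
  rw [Real.sqrt_le_left (by positivity), div_pow, div_le_iff₀ hb]
  rw [div_le_iff₀ (by positivity)] at h
  linarith

theorem IsUCBNetwork.confidenceFails_of_action_eq (hΦ : IsUCBNetwork Φ)
    (hi : armMean P i < bestMean P) (hj : armMean P j = bestMean P) {v : V} {t : ℕ} (ht : K ≤ t)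
    (hact : action Φ x t v = i) (hcard : 8 * Real.log t / gap P i ^ 2 ≤ #(pulls Φ x v i t)) :
    ConfidenceFails P Φ x i j (v, t) := by
  have hne : ∀ k, (pulls Φ x v k t).Nonempty := fun k => hΦ.pulls_nonempty ht
  have hpos : ∀ k, (0 : ℝ) < #(pulls Φ x v k t) := fun k => by exact_mod_cast (hne k).card_pos
  have hindex := hΦ.loop v t (playHistory Φ x v t) ht
    (fun k => (hne k).card_pos.trans_eq count_playHistory.symm) j
  rw [← action_eq_policy_playHistory Φ x t v, hact] at hindex
  simp only [History.ucbIndex, count_playHistory] at hindex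
  have hwidth := sqrt_div_le_half (hpos i) (gap_pos_iff.2 hi)
    (by rwa [← mul_assoc, show (4 : ℝ) * 2 = 8 by norm_num])
  rw [ConfidenceFails, ← avgReward_playHistory_sub_mul_card _ (hne i),
    ← avgReward_playHistory_sub_mul_card _ (hne j), ← neg_mul,
    sqrt_mul_le_mul_iff (hpos i), sqrt_mul_le_mul_iff (hpos j)]
  by_contra! hcon
  simp only [gap] at hwidth
  linarith [hcon.1, hcon.2]

theorem IsUCBNetwork.plays_subset_earlyPlays_union_confidenceFailures [DecidableEq V]
    (hΦ : IsUCBNetwork Φ) (hi : armMean P i < bestMean P) (hj : armMean P j = bestMean P)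
    {l n : ℕ} (hl : 8 * Real.log n / gap P i ^ 2 < l) :
    plays (fun p => action Φ x p.2 p.1 = i) univ n ⊆
      earlyPlays G (fun p => action Φ x p.2 p.1 = i) l n univ ∪
        confidenceFailures P Φ x i j n := by
  rintro ⟨v, t⟩ hp
  obtain ⟨⟨-, htn⟩, hact⟩ := mem_plays.1 hp
  obtain hearly | hlate := lt_or_ge #(pulls Φ x v i t) l
  · exact mem_union_left _ (mem_earlyPlays.2 ⟨hp, hearly⟩)
  have hlogn : 0 ≤ 8 * Real.log n / gap P i ^ 2 :=
    div_nonneg (mul_nonneg (by norm_num) (Real.log_natCast_nonneg n)) (sq_nonneg _)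
  have hl0 : 0 < l := by exact_mod_cast hlogn.trans_lt hl
  have hKt : K ≤ t := by
    by_contra! htK
    simp only [← hact, hΦ.pulls_action_eq_empty htK, card_empty] at hlate
    omega
  have ht0 : 0 < t := i.pos.trans_le hKt
  have hcard : 8 * Real.log t / gap P i ^ 2 ≤ #(pulls Φ x v i t) :=
    calc 8 * Real.log t / gap P i ^ 2
        ≤ 8 * Real.log n / gap P i ^ 2 := by gcongr
      _ ≤ (l : ℝ) := hl.le
      _ ≤ #(pulls Φ x v i t) := by exact_mod_cast hlate
  exact mem_union_right _ (mem_confidenceFailures.2 ⟨mem_Ico.2 ⟨hKt, htn⟩,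
    hΦ.confidenceFails_of_action_eq hi hj hKt hact hcard⟩)

theorem IsUCBNetwork.card_plays_le_add_card_confidenceFailures (hΦ : IsUCBNetwork Φ)
    (hi : armMean P i < bestMean P) (hj : armMean P j = bestMean P) {l n : ℕ}
    (hl : 8 * Real.log n / gap P i ^ 2 < l) :
    #(plays (fun p => action Φ x p.2 p.1 = i) univ n) ≤
      G.indepNum * l + Fintype.card V + #(confidenceFailures P Φ x i j n) := by
  classical
  exact (card_le_card (hΦ.plays_subset_earlyPlays_union_confidenceFailures hi hj hl)).trans <|
    (card_union_le _ _).trans <| Nat.add_le_add_right card_earlyPlays_univ_le _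

end ConfidenceBounds

section Measurability

open Finset

variable {V Ω : Type*} [Fintype V] {K : ℕ} {G : SimpleGraph V} {Φ : Policy K G}
  {X : V → Fin K → ℕ → Ω → ℝ} {t : ℕ}

/-- The array of rewards at the outcome `ω`. -/
abbrev realization (X : V → Fin K → ℕ → Ω → ℝ) (ω : Ω) : V → Fin K → ℕ → ℝ :=
  fun v i t => X v i t ω

theorem IsUCBNetwork.measurable_action (hΦ : IsUCBNetwork Φ) {_ : MeasurableSpace Ω}
    (hX : ∀ v i, ∀ s < t, Measurable (X v i s)) :
    Measurable fun ω => action Φ (realization X ω) t := by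
  induction t using Nat.strong_induction_on with | _ t ih => ?_
  refine measurable_pi_lambda _ fun v => ?_
  simp only [action_eq_policy_playHistory Φ _ t v]
  refine (hΦ.measurable v t).comp <|
    measurable_pi_lambda _ fun u => measurable_pi_lambda _ fun s => ?_
  have hact := measurable_pi_iff.1 (ih s s.2 fun v i r hr => hX v i r (hr.trans s.2)) u
  have hreward : Measurable fun p : Fin K × Ω => X u p.1 s p.2 :=
    measurable_from_prod_countable_right fun i => hX u i s s.2
  exact hact.prodMk (hreward.comp (hact.prodMk measurable_id))

theorem IsUCBNetwork.measurableSet_action_eq (hΦ : IsUCBNetwork Φ) {_ : MeasurableSpace Ω}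
    (hX : ∀ v i, ∀ s < t, Measurable (X v i s)) (i : Fin K) {S : Finset V} {p : V × ℕ}
    (hp : p ∈ S ×ˢ range t) : MeasurableSet {ω | action Φ (realization X ω) p.2 p.1 = i} :=
  measurable_pi_iff.1 (hΦ.measurable_action fun v j s hs =>
    hX v j s (hs.trans (mem_range.1 (mem_product.1 hp).2))) p.1 (measurableSet_singleton i)

@[to_additive]
theorem IsUCBNetwork.measurable_prod_pulls (hΦ : IsUCBNetwork Φ) {_ : MeasurableSpace Ω}
    {M : Type*} [CommMonoid M] [MeasurableSpace M] [MeasurableMul₂ M]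
    (hX : ∀ v i, ∀ s < t, Measurable (X v i s)) {f : ℝ → M} (hf : Measurable f) (v : V)
    (i : Fin K) :
    Measurable fun ω => ∏ p ∈ pulls Φ (realization X ω) v i t, f (X p.1 i p.2 ω) :=
  measurable_prod_filter (closedNbhd G v ×ˢ range t)
    (fun _ hp => hΦ.measurableSet_action_eq hX i hp)
    fun p hp => hf.comp (hX p.1 i p.2 (mem_range.1 (mem_product.1 hp).2))

theorem IsUCBNetwork.measurable_deviation (hΦ : IsUCBNetwork Φ) {_ : MeasurableSpace Ω}
    (hX : ∀ v i, ∀ s < t, Measurable (X v i s)) (c : ℝ) (v : V) (i : Fin K) :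
    Measurable fun ω => deviation Φ (realization X ω) c v i t :=
  hΦ.measurable_sum_pulls hX (measurable_id.sub_const c) v i

theorem IsUCBNetwork.measurable_card_pulls (hΦ : IsUCBNetwork Φ) {_ : MeasurableSpace Ω}
    (hX : ∀ v i, ∀ s < t, Measurable (X v i s)) (v : V) (i : Fin K) :
    Measurable fun ω => (#(pulls Φ (realization X ω) v i t) : ℝ) := by
  simp only [card_eq_sum_ones, Nat.cast_sum, Nat.cast_one]
  exact hΦ.measurable_sum_pulls hX measurable_const v i

end Measurability

section RewardAlgebra

variable {V Ω : Type*} {K : ℕ} {X : V → Fin K → ℕ → Ω → ℝ}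

/-- The σ-algebra generated by the rewards of the rounds in `T`. -/
abbrev rewardAlgebra (X : V → Fin K → ℕ → Ω → ℝ) (T : Set ℕ) : MeasurableSpace Ω :=
  ⨆ p ∈ {p : V × Fin K × ℕ | p.2.2 ∈ T}, MeasurableSpace.comap (X p.1 p.2.1 p.2.2) inferInstance

theorem measurable_rewardAlgebra (v : V) (i : Fin K) {T : Set ℕ} {t : ℕ} (ht : t ∈ T) :
    Measurable[rewardAlgebra X T] (X v i t) :=
  measurable_iff_comap_le.2 <|
    le_iSup₂_of_le (f := fun p (_ : p ∈ {p : V × Fin K × ℕ | p.2.2 ∈ T}) =>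
      MeasurableSpace.comap (X p.1 p.2.1 p.2.2) inferInstance) (v, i, t) ht le_rfl

variable {m₀ : MeasurableSpace Ω} {P : Fin K → Measure ℝ} {Pr : Measure Ω}

theorem IsRewardModel.rewardAlgebra_le (hX : IsRewardModel P X Pr) (T : Set ℕ) :
    rewardAlgebra X T ≤ m₀ :=
  iSup₂_le fun p _ => (hX.measurable p.1 p.2.1 p.2.2).comap_le

theorem IsRewardModel.indep_rewardAlgebra (hX : IsRewardModel P X Pr) {S T : Set ℕ}
    (hST : Disjoint S T) : Indep (rewardAlgebra X S) (rewardAlgebra X T) Pr :=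
  indep_iSup_of_disjoint
    (m := fun p : V × Fin K × ℕ => MeasurableSpace.comap (X p.1 p.2.1 p.2.2) inferInstance)
    (fun p => (hX.measurable p.1 p.2.1 p.2.2).comap_le) hX.indep
    (hST.preimage fun p : V × Fin K × ℕ => p.2.2)

end RewardAlgebra

section Supermartingale

open Finset

variable {V Ω : Type*} {K : ℕ} {G : SimpleGraph V} {X : V → Fin K → ℕ → Ω → ℝ}
  {_ : MeasurableSpace Ω} {P : Fin K → Measure ℝ} {Pr : Measure Ω}

theorem IsRewardModel.lintegral_prod_le_one (hX : IsRewardModel P X Pr)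
    {i : Fin K} {f : ℝ → ENNReal} (hf : Measurable f) (hfP : ∫⁻ y, f y ∂(P i) ≤ 1) (A : Finset V)
    (t : ℕ) : ∫⁻ ω, ∏ u ∈ A, f (X u i t ω) ∂Pr ≤ 1 := by
  have hindep : iIndepFun (fun u ω => f (X u i t ω)) Pr :=
    (hX.indep.precomp (g := fun u : V => (u, i, t)) fun u v h => congrArg Prod.fst h).comp
      (fun _ => f) fun _ => hf
  rw [lintegral_prod_eq_prod_lintegral_of_indepFun A _ hindep
    fun u => hf.comp (hX.measurable u i t)]
  refine prod_le_one' fun u _ => ?_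
  rwa [← lintegral_map hf (hX.measurable u i t), hX.law]

variable [Fintype V] {Φ : Policy K G}

/-- In each round the plays are determined by the rewards of the earlier rounds, so the new factors
have conditional expectation at most `1`. -/
theorem IsRewardModel.lintegral_prod_pulls_le_one [IsProbabilityMeasure Pr]
    (hX : IsRewardModel P X Pr) (hΦ : IsUCBNetwork Φ) {i : Fin K} {f : ℝ → ENNReal}
    (hf : Measurable f) (hfP : ∫⁻ y, f y ∂(P i) ≤ 1) (v : V) (t : ℕ) :
    ∫⁻ ω, ∏ p ∈ pulls Φ (realization X ω) v i t, f (X p.1 i p.2 ω) ∂Pr ≤ 1 := by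
  induction t with
  | zero => simp [pulls, plays]
  | succ t ih =>
    have hpast : ∀ v i, ∀ s < t, Measurable[rewardAlgebra X (Set.Iio t)] (X v i s) :=
      fun v i s hs => measurable_rewardAlgebra v i hs
    simp only [pulls, prod_plays_succ]
    refine (lintegral_mul_comp_le (hX.rewardAlgebra_le (Set.Iio t)) (hX.rewardAlgebra_le {t})
      (hX.indep_rewardAlgebra (by simp)) (D := fun ω => action Φ (realization X ω) t)
      (g := fun a ω => ∏ u ∈ closedNbhd G v with a u = i, f (X u i t ω)) ?_ ?_ ?_ ?_).trans ih
    · exact hΦ.measurable_action hpast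
    · exact hΦ.measurable_prod_pulls hpast hf v i
    · exact fun a => Finset.measurable_fun_prod _ fun u _ =>
        hf.comp (measurable_rewardAlgebra u i rfl)
    · exact fun a => hX.lintegral_prod_le_one hf hfP _ t

theorem IsRewardModel.lintegral_exp_deviation_le_one [IsProbabilityMeasure Pr]
    (hX : IsRewardModel P X Pr) (hΦ : IsUCBNetwork Φ) (v : V) (i : Fin K)
    [IsProbabilityMeasure (P i)] (t : ℕ) (lam : ℝ) :
    ∫⁻ ω, ENNReal.ofReal (Real.exp (lam * deviation Φ (realization X ω) (armMean P i) v i t -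
      lam ^ 2 / 8 * #(pulls Φ (realization X ω) v i t))) ∂Pr ≤ 1 := by
  refine (lintegral_congr fun ω => ?_).trans_le <| hX.lintegral_prod_pulls_le_one hΦ (by fun_prop)
    (lintegral_exp_mul_sub_mean_le_one (hX.bounded i) lam) v t
  rw [← ENNReal.ofReal_prod_of_nonneg fun _ _ => (Real.exp_pos _).le, ← Real.exp_sum,
    sum_sub_distrib, ← mul_sum, sum_const, nsmul_eq_mul, mul_comm (lam ^ 2 / 8), deviation, armMean]

end Supermartingale

section Failures

open Finset

variable {V Ω : Type*} [Fintype V] {K : ℕ} {G : SimpleGraph V} {Φ : Policy K G}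
  {X : V → Fin K → ℕ → Ω → ℝ} {_ : MeasurableSpace Ω} {P : Fin K → Measure ℝ} {Pr : Measure Ω}

theorem IsUCBNetwork.measurableSet_confidenceFails (hΦ : IsUCBNetwork Φ)
    (hX : ∀ v i t, Measurable (X v i t)) (i j : Fin K) (p : V × ℕ) :
    MeasurableSet {ω | ConfidenceFails P Φ (realization X ω) i j p} := by
  have hpast : ∀ v i, ∀ s < p.2, Measurable (X v i s) := fun v i s _ => hX v i s
  have hwidth : ∀ k, Measurable fun ω =>
      √(2 * Real.log p.2 * #(pulls Φ (realization X ω) p.1 k p.2)) :=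
    fun k => ((hΦ.measurable_card_pulls hpast p.1 k).const_mul _).sqrt
  exact (measurableSet_le (hwidth i) (hΦ.measurable_deviation hpast _ p.1 i)).union
    (measurableSet_le (hwidth j) (hΦ.measurable_deviation hpast _ p.1 j).neg)

variable [IsProbabilityMeasure Pr]

theorem IsUCBNetwork.integrable_card_confidenceFailures (hΦ : IsUCBNetwork Φ)
    (hX : ∀ v i t, Measurable (X v i t)) (i j : Fin K) (n : ℕ) :
    Integrable (fun ω => (#(confidenceFailures P Φ (realization X ω) i j n) : ℝ)) Pr := by
  classical
  exact integrable_card_filter (univ ×ˢ Ico K n)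
    fun p _ => hΦ.measurableSet_confidenceFails hX i j p

variable [∀ i, IsProbabilityMeasure (P i)]

theorem IsRewardModel.measure_sqrt_le_mul_deviation_le (hX : IsRewardModel P X Pr)
    (hΦ : IsUCBNetwork Φ) {ε : ℝ} (hε : ε ^ 2 = 1) (v : V) (i : Fin K) {t : ℕ} (ht : K ≤ t) :
    Pr {ω | √(2 * Real.log t * #(pulls Φ (realization X ω) v i t)) ≤
      ε * deviation Φ (realization X ω) (armMean P i) v i t} ≤ ENNReal.ofReal ((t : ℝ) ^ 3)⁻¹ := by
  have hpast : ∀ v i, ∀ s < t, Measurable (X v i s) := fun v i s _ => hX.measurable v i s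
  refine measure_sqrt_log_le_le_inv_pow_three (q := #(closedNbhd G v))
    ((hΦ.measurable_deviation hpast _ v i).const_mul ε).aemeasurable
    (hΦ.measurable_card_pulls hpast v i).aemeasurable (fun lam => ?_)
    (by exact_mod_cast card_pos.2 ⟨v, self_mem_closedNbhd v⟩)
    (fun _ => by exact_mod_cast hΦ.card_closedNbhd_le_card_pulls ht)
    (fun _ => by exact_mod_cast card_plays_le) (i.pos.trans_le ht).ne'
  simpa only [mul_pow, hε, mul_one, mul_assoc] using
    hX.lintegral_exp_deviation_le_one hΦ v i t (lam * ε)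

theorem IsRewardModel.measureReal_confidenceFails_le (hX : IsRewardModel P X Pr)
    (hΦ : IsUCBNetwork Φ) (i j : Fin K) {p : V × ℕ} (hp : K ≤ p.2) :
    Pr.real {ω | ConfidenceFails P Φ (realization X ω) i j p} ≤ 2 * ((p.2 : ℝ) ^ 3)⁻¹ := by
  have hupper := hX.measure_sqrt_le_mul_deviation_le hΦ (ε := 1) (by norm_num) p.1 i hp
  have hlower := hX.measure_sqrt_le_mul_deviation_le hΦ (ε := -1) (by norm_num) p.1 j hp
  simp only [one_mul, neg_one_mul] at hupper hlower
  rw [two_mul]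
  exact (measureReal_union_le _ _).trans <| add_le_add
    (ENNReal.toReal_le_of_le_ofReal (by positivity) hupper)
    (ENNReal.toReal_le_of_le_ofReal (by positivity) hlower)

theorem IsRewardModel.integral_card_confidenceFailures_le (hX : IsRewardModel P X Pr)
    (hΦ : IsUCBNetwork Φ) (hK : 2 ≤ K) (i j : Fin K) (n : ℕ) :
    ∫ ω, (#(confidenceFailures P Φ (realization X ω) i j n) : ℝ) ∂Pr ≤ Fintype.card V := by
  classical
  calc ∫ ω, (#(confidenceFailures P Φ (realization X ω) i j n) : ℝ) ∂Pr
      = ∑ p ∈ univ ×ˢ Ico K n, Pr.real {ω | ConfidenceFails P Φ (realization X ω) i j p} :=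
        integral_card_filter (univ ×ˢ Ico K n)
          fun p _ => hΦ.measurableSet_confidenceFails hX.measurable i j p
    _ ≤ ∑ p ∈ (univ : Finset V) ×ˢ Ico K n, 2 * ((p.2 : ℝ) ^ 3)⁻¹ :=
        sum_le_sum fun p hp =>
          hX.measureReal_confidenceFails_le hΦ i j (mem_Ico.1 (mem_product.1 hp).2).1
    _ ≤ ∑ _v : V, (1 : ℝ) := by
        rw [sum_product]
        exact sum_le_sum fun v _ => sum_Ico_two_mul_inv_pow_three_le_one hK n
    _ = Fintype.card V := by rw [sum_const, nsmul_one, card_univ]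

end Failures

section Regret

open Finset

variable {V Ω : Type*} [Fintype V] {K : ℕ} {G : SimpleGraph V} {Φ : Policy K G}
  {X : V → Fin K → ℕ → Ω → ℝ} {P : Fin K → Measure ℝ}

theorem networkRegret_eq_sum_card_plays_mul_gap (P : Fin K → Measure ℝ) (Φ : Policy K G)
    (x : V → Fin K → ℕ → ℝ) (n : ℕ) : networkRegret P Φ x n =
      ∑ i, #(plays (fun p => action Φ x p.2 p.1 = i) univ n) * gap P i := by
  simp only [plays, ← nsmul_eq_mul, ← sum_const]
  rw [sum_fiberwise', sum_product]
  rfl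

variable {_ : MeasurableSpace Ω} {Pr : Measure Ω} [IsProbabilityMeasure Pr]

theorem IsUCBNetwork.integrable_card_plays (hΦ : IsUCBNetwork Φ)
    (hX : ∀ v i t, Measurable (X v i t)) (i : Fin K) (n : ℕ) :
    Integrable (fun ω =>
      (#(plays (fun p => action Φ (realization X ω) p.2 p.1 = i) univ n) : ℝ)) Pr :=
  integrable_card_filter _ fun _ hp => hΦ.measurableSet_action_eq (fun v i s _ => hX v i s) i hp

theorem IsUCBNetwork.integrable_networkRegret (hΦ : IsUCBNetwork Φ)
    (hX : ∀ v i t, Measurable (X v i t)) (n : ℕ) :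
    Integrable (fun ω => networkRegret P Φ (realization X ω) n) Pr := by
  simp only [networkRegret_eq_sum_card_plays_mul_gap]
  exact integrable_finsetSum _ fun i _ => (hΦ.integrable_card_plays hX i n).mul_const _

variable [∀ i, IsProbabilityMeasure (P i)]

theorem IsRewardModel.integral_card_plays_le (hX : IsRewardModel P X Pr) (hΦ : IsUCBNetwork Φ)
    {i : Fin K} (hi : armMean P i < bestMean P) {n : ℕ} (hn : 1 ≤ n) :
    ∫ ω, (#(plays (fun p => action Φ (realization X ω) p.2 p.1 = i) univ n) : ℝ) ∂Pr ≤
      G.indepNum * (8 * Real.log n / gap P i ^ 2 + 1) + 2 * Fintype.card V := by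
  have : Nonempty (Fin K) := ⟨i⟩
  obtain ⟨j, hj⟩ := exists_armMean_eq_bestMean P
  have hK : 2 ≤ K := by
    have hij : i ≠ j := by rintro rfl; exact hi.ne hj
    omega
  have hlog : 0 ≤ 8 * Real.log n / gap P i ^ 2 :=
    div_nonneg (mul_nonneg (by norm_num) (Real.log_nonneg (by exact_mod_cast hn))) (sq_nonneg _)
  have hfail := hΦ.integrable_card_confidenceFailures (P := P) (Pr := Pr) hX.measurable i j n
  let l := ⌊8 * Real.log n / gap P i ^ 2⌋₊ + 1
  calc ∫ ω, (#(plays (fun p => action Φ (realization X ω) p.2 p.1 = i) univ n) : ℝ) ∂Pr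
      ≤ ∫ ω, ((G.indepNum * l + Fintype.card V : ℝ) +
          #(confidenceFailures P Φ (realization X ω) i j n)) ∂Pr :=
        integral_mono (hΦ.integrable_card_plays hX.measurable i n)
          ((integrable_const _).add hfail) fun ω => by
            have hpath := hΦ.card_plays_le_add_card_confidenceFailures (x := realization X ω) hi hj
              (n := n) (l := l) (by exact_mod_cast Nat.lt_floor_add_one _)
            beta_reduce
            exact_mod_cast hpath
    _ = (G.indepNum * l + Fintype.card V) +
          ∫ ω, (#(confidenceFailures P Φ (realization X ω) i j n) : ℝ) ∂Pr := by
        rw [integral_add (integrable_const _) hfail, integral_const, probReal_univ, one_smul]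
    _ ≤ (G.indepNum * (8 * Real.log n / gap P i ^ 2 + 1) + Fintype.card V) + Fintype.card V := by
        gcongr
        · simpa [l] using Nat.floor_le hlog
        · exact hX.integral_card_confidenceFailures_le hΦ hK i j n
    _ = G.indepNum * (8 * Real.log n / gap P i ^ 2 + 1) + 2 * Fintype.card V := by ring

theorem IsRewardModel.integral_networkRegret_le (hX : IsRewardModel P X Pr) (hΦ : IsUCBNetwork Φ)
    {n : ℕ} (hn : 1 ≤ n) :
    ∫ ω, networkRegret P Φ (realization X ω) n ∂Pr ≤
      G.indepNum * mainTerm P n + 2 * Fintype.card V * ∑ i, gap P i := by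
  classical
  let meanPlays : Fin K → ℝ := fun i =>
    ∫ ω, (#(plays (fun p => action Φ (realization X ω) p.2 p.1 = i) univ n) : ℝ) ∂Pr
  calc ∫ ω, networkRegret P Φ (realization X ω) n ∂Pr
      = ∑ i, meanPlays i * gap P i := by
        simp only [networkRegret_eq_sum_card_plays_mul_gap]
        rw [integral_finsetSum _ fun i _ =>
          (hΦ.integrable_card_plays hX.measurable i n).mul_const (gap P i)]
        simp only [integral_mul_const, meanPlays]
    _ = ∑ i with armMean P i < bestMean P, meanPlays i * gap P i :=
        (sum_filter_of_ne fun i _ h => of_not_not fun hi =>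
          h (by rw [gap_eq_zero_of_not_lt hi, mul_zero])).symm
    _ ≤ ∑ i with armMean P i < bestMean P,
          (G.indepNum * (8 * Real.log n / gap P i + gap P i) + 2 * Fintype.card V * gap P i) := by
        refine sum_le_sum fun i hi => ?_
        have hsub := (mem_filter.1 hi).2
        have hgap := gap_pos_iff.2 hsub
        calc meanPlays i * gap P i
            ≤ (G.indepNum * (8 * Real.log n / gap P i ^ 2 + 1) + 2 * Fintype.card V) * gap P i := by
              gcongr; exact hX.integral_card_plays_le hΦ hsub hn
          _ = G.indepNum * (8 * Real.log n / gap P i + gap P i) + 2 * Fintype.card V * gap P i := by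
              field_simp
    _ = G.indepNum * mainTerm P n +
          2 * Fintype.card V * ∑ i with armMean P i < bestMean P, gap P i := by
        rw [sum_add_distrib, mainTerm, mul_sum, mul_sum]
    _ ≤ G.indepNum * mainTerm P n + 2 * Fintype.card V * ∑ i, gap P i := by
        gcongr
        · exact fun i _ _ => gap_nonneg i
        · exact filter_subset _ _

end Regret

section Constants

variable {K : ℕ} {P : Fin K → Measure ℝ} {β : ℝ}

theorem two_le_addTerm_coeff (hβ : β ∈ Set.Ioo (1 / 4 : ℝ) 1) :
    2 ≤ 2 / (4 * β - 1) + 2 / ((4 * β - 1) ^ 2 * Real.log (1 / β)) := by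
  obtain ⟨hβ4, hβ1⟩ := hβ
  have hβ0 : 0 < β := by linarith
  have h4β : 0 < 4 * β - 1 := by linarith
  have : 0 < 1 - β := by linarith
  have hlog_pos : 0 < Real.log (1 / β) := Real.log_pos ((one_lt_div hβ0).2 hβ1)
  have hlog_le : Real.log (1 / β) ≤ (1 - β) / β := by
    have h := Real.log_le_sub_one_of_pos (one_div_pos.2 hβ0)
    rwa [div_sub_one hβ0.ne'] at h
  calc 2 ≤ 2 * ((4 * β - 1) * (1 - β) + β) / ((4 * β - 1) ^ 2 * (1 - β)) := by
        rw [le_div_iff₀ (by positivity)]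
        nlinarith [mul_nonneg h4β.le (sq_nonneg (4 * β - 1 - 2))]
    _ = 2 / (4 * β - 1) + 2 / ((4 * β - 1) ^ 2 * ((1 - β) / β)) := by field_simp
    _ ≤ 2 / (4 * β - 1) + 2 / ((4 * β - 1) ^ 2 * Real.log (1 / β)) := by gcongr

theorem two_mul_sum_gap_le_addTerm (hβ : β ∈ Set.Ioo (1 / 4 : ℝ) 1) (m : ℕ) :
    2 * m * ∑ i, gap P i ≤ addTerm P m β := by
  rw [addTerm, mul_comm 2 (m : ℝ)]
  have hgap : 0 ≤ ∑ i, gap P i := Finset.sum_nonneg fun i _ => gap_nonneg i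
  gcongr
  exact two_le_addTerm_coeff hβ

end Constants

end NetworkBandit

theorem mainTheorem8_general {V Ω : Type*} [Fintype V] [MeasurableSpace Ω] (Pr : Measure Ω)
    [IsProbabilityMeasure Pr] (G : SimpleGraph V) (K : ℕ) (P : Fin K → Measure ℝ)
    [∀ i, IsProbabilityMeasure (P i)] (X : V → Fin K → ℕ → Ω → ℝ) (hX : IsRewardModel P X Pr)
    (Φ : Policy K G) (hΦ : IsUCBNetwork Φ) (n : ℕ) (hn : 1 ≤ n) :
    Integrable (fun ω => networkRegret P Φ (fun v i t => X v i t ω) n) Pr ∧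
    ∫ ω, networkRegret P Φ (fun v i t => X v i t ω) n ∂Pr ≤
      G.indepNum * mainTerm P n + 2 * Fintype.card V * ∑ i, gap P i :=
  ⟨hΦ.integrable_networkRegret hX.measurable n, hX.integral_networkRegret_le hΦ hn⟩

theorem mainTheorem8 {V Ω : Type*} [Fintype V] [MeasurableSpace Ω]
    (Pr : Measure Ω) [IsProbabilityMeasure Pr]
    (G : SimpleGraph V) (m : ℕ) (hm : Fintype.card V = m) (K : ℕ) (hK : 1 ≤ K)
    (P : Fin K → Measure ℝ) [∀ i, IsProbabilityMeasure (P i)]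
    (X : V → Fin K → ℕ → Ω → ℝ) (hX : IsRewardModel P X Pr)
    (Φ : Policy K G) (hΦ : IsUCBNetwork Φ)
    (n : ℕ) (hn : 1 ≤ n) (β : ℝ) (hβ : β ∈ Set.Ioo (1 / 4 : ℝ) 1)
    (R : Ω → ℝ) (hR : ∀ ω, R ω = networkRegret P Φ (fun v i t => X v i t ω) n) :
    Integrable R Pr ∧
    -- fully connected network
    (G = ⊤ → ∫ ω, R ω ∂Pr ≤ mainTerm P n + addTerm P m β) ∧
    -- circular network
    (2 ≤ m → Nonempty (G ≃g SimpleGraph.cycleGraph m) →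
      ∫ ω, R ω ∂Pr ≤ ((m / 2 : ℕ) : ℝ) * mainTerm P n + addTerm P m β) ∧
    -- star network
    (2 ≤ m → (∃ c : V, G = SimpleGraph.starGraph c) →
      ∫ ω, R ω ∂Pr ≤ ((m : ℝ) - 1) * mainTerm P n + addTerm P m β) ∧
    -- fully disconnected network
    (G = ⊥ → ∫ ω, R ω ∂Pr ≤ (m : ℝ) * mainTerm P n + addTerm P m β) := by
  obtain rfl : R = _ := funext hR
  subst hm
  obtain ⟨hint, hle⟩ := mainTheorem8_general Pr G K P X hX Φ hΦ n hn
  have hbound {C : ℝ} (hC : (G.indepNum : ℝ) ≤ C) :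
      ∫ ω, networkRegret P Φ (fun v i t => X v i t ω) n ∂Pr ≤
        C * mainTerm P n + addTerm P (Fintype.card V) β :=
    hle.trans <| add_le_add (mul_le_mul_of_nonneg_right hC mainTerm_nonneg)
      (two_mul_sum_gap_le_addTerm hβ _)
  refine ⟨hint, ?_, ?_, ?_, ?_⟩
  · rintro rfl
    simpa only [one_mul] using hbound (C := 1) (by exact_mod_cast indepNum_top_le_one)
  · rintro hm ⟨e⟩
    exact hbound (by exact_mod_cast (indepNum_le_of_iso e).trans (indepNum_cycleGraph_le hm))
  · rintro hm ⟨c, rfl⟩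
    have : Nontrivial V := Fintype.one_lt_card_iff_nontrivial.1 hm
    exact hbound (le_sub_iff_add_le.2 (by exact_mod_cast indepNum_lt_card (starGraph_ne_bot c)))
  · rintro rfl
    exact hbound (by exact_mod_cast indepNum_le_card ⊥)
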